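/- Let $V$ be a real vector space of finite dimension $m\ge 4$. Let $S^2(V^*)$ be the space of symmetric bilinear forms on $V$, and regard $S^2(V^*)\otimes V$ as the space of symmetric bilinear maps $V\times V\to V$ and $\otimes^2V^*\otimes\operatorname{End}(V)$ as the space of bilinear maps $V\times V\to\operatorname{End}(V)$. For $\mathcal R\in\otimes^2V^*\otimes\operatorname{End}(V)$ put $\rho_{14}(\mathcal R)(x,y)=\operatorname{Tr}\{z\mapsto\mathcal R(z,x)y\}$ and $\rho_{34}(\mathcal R)(x,y)=\operatorname{Tr}\{z\mapsto\mathcal R(x,y)z\}$. Let $\mathfrak F(V)\subset\otimes^2V^*\otimes\operatorname{End}(V)$ be the space of affine curvature operators, i.e. of those $\mathcal F$ such that, for all $x,y,z\in V$, $$\mathcal F(x,y)z=-\mathcal F(y,x)z,\qquad \mathcal F(x,y)z+\mathcal F(y,z)x+\mathcal F(z,x)y=0,$$ $$\rho_{14}(\mathcal F)(x,y)=\rho_{14}(\mathcal F)(y,x),\qquad \rho_{34}(\mathcal F)=0.$$ Let $\sigma:S^2(V^*)\to\mathfrak F(V)$ be the linear map $$\sigma(\psi)(x,y)z=\tfrac1{1-m}\{\psi(x,z)y-\psi(y,z)x\},$$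 which satisfies $\rho_{14}(\sigma(\psi))=\psi$; its image $\sigma(S^2(V^*))$ is the $S^2(V^*)$-summand of $\mathfrak F(V)$ (a complement of $\ker\rho_{14}\cap\mathfrak F(V)$). **Theorem 4.3.** (1) For $h\in S^2(V^*)$ define $\mathcal R_h(x,y)z=h(y,z)x-h(x,z)y$. Then $\mathcal R_h\in\sigma(S^2(V^*))$ for every $h\in S^2(V^*)$, and $$\sigma(S^2(V^*))=\operatorname{Span}_{h\in S^2(V^*)}\{\mathcal R_h\}.$$ (2) For $\mathcal C\in S^2(V^*)\otimes V$ define $\mathcal R_{\mathcal C}(w,v)u=\mathcal C(v,\mathcal C(w,u))-\mathcal C(w,\mathcal C(v,u))$. Then $\mathcal R_{\mathcal C}\in\mathfrak F(V)$ for every $\mathcal C\in S^2(V^*)\otimes V$, and $$\mathfrak F(V)=\operatorname{Span}_{\mathcal C\in S^2(V^*)\otimes V}\{\mathcal R_{\mathcal C}\}.$$ -/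

import Mathlib

namespace AffineCurvature

variable (V : Type*) [AddCommGroup V] [Module ℝ V]

/-- The space `⊗² V* ⊗ End(V)`, realised as the space of `End(V)`-valued bilinear maps
`(x, y) ↦ 𝓡(x, y)`. -/
abbrev OpTensor : Type _ := V →ₗ[ℝ] V →ₗ[ℝ] Module.End ℝ V

/-- The symmetric bilinear maps `V × V → W`. For `W = ℝ` this is `S²(V*)`, and for `W = V` (with `V`
finite dimensional) it is `S²(V*) ⊗ V`. -/
def symBilin (W : Type*) [AddCommGroup W] [Module ℝ W] : Submodule ℝ (V →ₗ[ℝ] V →ₗ[ℝ] W) where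
  carrier := {B | ∀ x y, B x y = B y x}
  zero_mem' := fun _ _ => rfl
  add_mem' := fun {A B} hA hB x y => by simp [hA x y, hB x y]
  smul_mem' := fun c B hB x y => by simp [hB x y]

/-- `S²(V*)`, the symmetric bilinear forms on `V`. -/
abbrev S2 : Submodule ℝ (V →ₗ[ℝ] V →ₗ[ℝ] ℝ) := symBilin V ℝ

/-- `S²(V*) ⊗ V`, the symmetric bilinear maps `V × V → V`. -/
abbrev S2V : Submodule ℝ (V →ₗ[ℝ] V →ₗ[ℝ] V) := symBilin V V

variable {V}

/-- The trace `ρ₁₄(𝓡)(x, y) = Tr {z ↦ 𝓡(z, x) y}`. -/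
noncomputable def rho14 (R : OpTensor V) : V →ₗ[ℝ] V →ₗ[ℝ] ℝ :=
  LinearMap.mk₂ ℝ (fun x y => LinearMap.trace ℝ V ((R.flip x).flip y))
    (fun x₁ x₂ y => by rw [← map_add]; congr 1; ext z; simp)
    (fun c x y => by rw [← map_smul]; congr 1; ext z; simp)
    (fun x y₁ y₂ => by rw [← map_add]; congr 1; ext z; simp)
    (fun c x y => by rw [← map_smul]; congr 1; ext z; simp)

/-- The trace `ρ₃₄(𝓡)(x, y) = Tr {z ↦ 𝓡(x, y) z}`. -/
noncomputable def rho34 (R : OpTensor V) : V →ₗ[ℝ] V →ₗ[ℝ] ℝ :=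
  R.compr₂ (LinearMap.trace ℝ V)

variable (V)

/-- The space `𝔉(V)` of affine curvature operators: antisymmetry, the first Bianchi identity,
symmetry of `ρ₁₄`, and vanishing of `ρ₃₄`. -/
def affineCurv : Submodule ℝ (OpTensor V) where
  carrier := {F | (∀ x y z, F x y z = -F y x z) ∧
    (∀ x y z, F x y z + F y z x + F z x y = 0) ∧
    (∀ x y, rho14 F x y = rho14 F y x) ∧
    rho34 F = 0}
  zero_mem' := by
    refine ⟨by simp, by simp, fun x y => ?_, ?_⟩
    · have h : ∀ a b : V, ((0 : OpTensor V).flip a).flip b = 0 := fun a b => by ext; simp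
      simp [rho14, h]
    · ext; simp [rho34]
  add_mem' := by
    rintro A B ⟨a1, a2, a3, a4⟩ ⟨b1, b2, b3, b4⟩
    have h : ∀ a b : V, rho14 (A + B) a b = rho14 A a b + rho14 B a b := fun a b => by
      simp only [rho14, LinearMap.mk₂_apply, ← map_add]; congr 1
    refine ⟨fun x y z => ?_, fun x y z => ?_, fun x y => ?_, ?_⟩
    · simp only [LinearMap.add_apply, a1 x y z, b1 x y z]; abel
    · have := congrArg₂ (· + ·) (a2 x y z) (b2 x y z)
      simp only [LinearMap.add_apply, add_zero] at this ⊢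
      rw [← this]; abel
    · rw [h, h, a3, b3]
    · have : rho34 (A + B) = rho34 A + rho34 B := by ext; simp [rho34]
      rw [this, a4, b4, add_zero]
  smul_mem' := by
    rintro c A ⟨a1, a2, a3, a4⟩
    have h : ∀ a b : V, rho14 (c • A) a b = c * rho14 A a b := fun a b => by
      simp only [rho14, LinearMap.mk₂_apply]; rw [← smul_eq_mul, ← LinearMap.map_smul]; congr 1
    refine ⟨fun x y z => ?_, fun x y z => ?_, fun x y => ?_, ?_⟩
    · simp only [LinearMap.smul_apply, a1 x y z, smul_neg]
    · simp only [LinearMap.smul_apply, ← smul_add, a2, smul_zero]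
    · rw [h, h, a3]
    · have : rho34 (c • A) = c • rho34 A := by ext; simp [rho34]
      rw [this, a4, smul_zero]

variable {V}

/-- `𝓡_h(x, y) z = h(y, z) x - h(x, z) y`. -/
def opOfForm (h : V →ₗ[ℝ] V →ₗ[ℝ] ℝ) : OpTensor V :=
  LinearMap.mk₂ ℝ (fun x y => (h y).smulRight x - (h x).smulRight y)
    (fun x₁ x₂ y => by ext z; simp [add_smul]; abel)
    (fun c x y => by ext z; simp [smul_sub, mul_smul, smul_comm c])
    (fun x y₁ y₂ => by ext z; simp [add_smul]; abel)
    (fun c x y => by ext z; simp [smul_sub, mul_smul, smul_comm c])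

/-- `𝓡_𝓒(w, v) u = 𝓒(v, 𝓒(w, u)) - 𝓒(w, 𝓒(v, u))`. -/
def opOfSymMap (C : V →ₗ[ℝ] V →ₗ[ℝ] V) : OpTensor V :=
  LinearMap.mk₂ ℝ (fun w v => C v ∘ₗ C w - C w ∘ₗ C v)
    (fun w₁ w₂ v => by ext u; simp; abel)
    (fun c w v => by ext u; simp [smul_sub])
    (fun w v₁ v₂ => by ext u; simp; abel)
    (fun c w v => by ext u; simp [smul_sub])

variable (V)

/-- The splitting `σ : S²(V*) → 𝔉(V)` of the trace `ρ₁₄`, where `m = dim V`: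
`σ(ψ)(x, y) z = (1 / (1 - m)) (ψ(x, z) y - ψ(y, z) x)`. -/
noncomputable def sigmaS : S2 V →ₗ[ℝ] OpTensor V where
  toFun ψ := LinearMap.mk₂ ℝ
    (fun x y => (1 / (1 - (Module.finrank ℝ V : ℝ))) •
      ((ψ.1 x).smulRight y - (ψ.1 y).smulRight x))
    (fun x₁ x₂ y => by rw [← smul_add]; congr 1; ext z; simp [add_smul]; abel)
    (fun c x y => by rw [smul_comm c]; congr 1; ext z; simp [smul_sub, mul_smul, smul_comm c])
    (fun x y₁ y₂ => by rw [← smul_add]; congr 1; ext z; simp [add_smul]; abel)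
    (fun c x y => by rw [smul_comm c]; congr 1; ext z; simp [smul_sub, mul_smul, smul_comm c])
  map_add' := fun ψ φ => by
    ext x y z
    simp only [LinearMap.mk₂_apply, LinearMap.add_apply, Submodule.coe_add, LinearMap.smul_apply,
      LinearMap.sub_apply, LinearMap.smulRight_apply, add_smul, ← smul_add]
    congr 1; abel
  map_smul' := fun c ψ => by
    ext x y z
    simp only [LinearMap.mk₂_apply, Submodule.coe_smul, LinearMap.smul_apply,
      LinearMap.sub_apply, LinearMap.smulRight_apply, RingHom.id_apply, smul_eq_mul, mul_smul,
      smul_sub, smul_comm c]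

/-- The `S²(V*)`-summand `σ(S²(V*))` of `𝔉(V) = 𝔘(V) ⊕ σ(S²(V*))`, where `𝔘(V)` is the kernel
of `ρ₁₄` on `𝔉(V)`. -/
noncomputable def symSummand : Submodule ℝ (OpTensor V) := LinearMap.range (sigmaS V)

variable {V}

theorem sigmaS_apply (ψ : S2 V) (x y z : V) : sigmaS V ψ x y z =
    (1 / (1 - (Module.finrank ℝ V : ℝ))) • (ψ.1 x z • y - ψ.1 y z • x) := rfl

/-- `σ` is a section of `ρ₁₄`. -/
theorem rho14_sigmaS [FiniteDimensional ℝ V] (hV : 2 ≤ Module.finrank ℝ V) (ψ : S2 V) :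
    rho14 (sigmaS V ψ) = ψ.1 := by
  have hm : (1 - (Module.finrank ℝ V : ℝ)) ≠ 0 := by
    have : (2 : ℝ) ≤ Module.finrank ℝ V := by exact_mod_cast hV
    linarith
  ext x y
  have h : ((sigmaS V ψ).flip x).flip y = (1 / (1 - (Module.finrank ℝ V : ℝ))) •
      ((ψ.1 y).smulRight x - (ψ.1 x y) • LinearMap.id) := by
    ext z
    simp [sigmaS_apply, ψ.2 z y]
  have ht : LinearMap.trace ℝ V ((ψ.1 y).smulRight x) = ψ.1 y x := by
    simp [LinearMap.trace_smulRight]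
  simp only [rho14, LinearMap.mk₂_apply, h, map_smul, map_sub, ht, LinearMap.trace_id, smul_eq_mul,
    ψ.2 y x]
  field_simp

/-- `σ` takes values in `𝔉(V)`. -/
theorem sigmaS_mem [FiniteDimensional ℝ V] (hV : 2 ≤ Module.finrank ℝ V) (ψ : S2 V) :
    sigmaS V ψ ∈ affineCurv V := by
  refine ⟨fun x y z => ?_, fun x y z => ?_, fun x y => ?_, ?_⟩
  · rw [sigmaS_apply, sigmaS_apply, ← smul_neg, neg_sub]
  · rw [sigmaS_apply, sigmaS_apply, sigmaS_apply, ← smul_add, ← smul_add, ψ.2 y x, ψ.2 z x,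
      ψ.2 z y]
    convert smul_zero _ using 2
    abel
  · rw [rho14_sigmaS hV, ψ.2 x y]
  · ext x y
    have h : sigmaS V ψ x y = (1 / (1 - (Module.finrank ℝ V : ℝ))) •
      ((ψ.1 x).smulRight y - (ψ.1 y).smulRight x) := rfl
    have ht : ∀ (f : V →ₗ[ℝ] ℝ) (v : V), LinearMap.trace ℝ V (f.smulRight v) = f v := by
      simp [LinearMap.trace_smulRight]
    simp [rho34, h, ht, ψ.2 x y]

end AffineCurvature

namespace AffineCurvature

section

variable {V : Type*} [AddCommGroup V] [Module ℝ V]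

/-! Part (1) is a rescaling: `σ(ψ)` is `(m - 1)⁻¹ 𝓡_ψ`, and the scalar is invertible.

In part (2), each `𝓡_C(w, v)` is the commutator of `C v` and `C w`, which gives membership in
`𝔉(V)`. For the converse, `C ↦ 𝓡_C` is quadratic, so the span also contains its polarizations. Given
`F` in `𝔉(V)`, set `E v w u = F w v u + F u v w`: it is symmetric in `w, u`, and Bianchi recovers
`3F` from its antisymmetrization in `v, w`. Polarizing against a basis and summing contracts `E`
into `3(m + 1) F + 𝓡_ρ`, with `ρ = ρ₁₄(F)` (`sum_polarOp_symTensor`). Since `𝓡_ρ` is itself a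
multiple of a polarization (`opOfForm_mem_symMapSpan`), `F` lies in the span. -/

/-- The polarization `𝓡_{C + D} - 𝓡_C - 𝓡_D` of the quadratic map `C ↦ 𝓡_C`. -/
def polarOp (C D : V →ₗ[ℝ] V →ₗ[ℝ] V) : OpTensor V :=
  opOfSymMap (C + D) - opOfSymMap C - opOfSymMap D

theorem opOfSymMap_apply (C : V →ₗ[ℝ] V →ₗ[ℝ] V) (w v u : V) :
    opOfSymMap C w v u = C v (C w u) - C w (C v u) := rfl

theorem opOfForm_apply (h : V →ₗ[ℝ] V →ₗ[ℝ] ℝ) (x y z : V) :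
    opOfForm h x y z = h y z • x - h x z • y := rfl

theorem polarOp_apply (C D : V →ₗ[ℝ] V →ₗ[ℝ] V) (w v u : V) :
    polarOp C D w v u =
      C v (D w u) + D v (C w u) - (C w (D v u) + D w (C v u)) := by
  simp only [polarOp, LinearMap.sub_apply, opOfSymMap_apply, LinearMap.add_apply, map_add]
  abel

/-- The span of the operators `𝓡_C`. -/
def symMapSpan (V : Type*) [AddCommGroup V] [Module ℝ V] : Submodule ℝ (OpTensor V) :=
  Submodule.span ℝ {R | ∃ C ∈ S2V V, R = opOfSymMap C}

theorem opOfSymMap_mem_symMapSpan {C : V →ₗ[ℝ] V →ₗ[ℝ] V} (hC : C ∈ S2V V) :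
    opOfSymMap C ∈ symMapSpan V :=
  Submodule.subset_span ⟨C, hC, rfl⟩

theorem polarOp_mem_symMapSpan {C D : V →ₗ[ℝ] V →ₗ[ℝ] V} (hC : C ∈ S2V V) (hD : D ∈ S2V V) :
    polarOp C D ∈ symMapSpan V := by
  have h := opOfSymMap_mem_symMapSpan (Submodule.add_mem _ hC hD)
  have h1 := opOfSymMap_mem_symMapSpan hC
  have h2 := opOfSymMap_mem_symMapSpan hD
  have h3 := Submodule.sub_mem (R := ℝ) (M := OpTensor V) _ h h1
  have h4 := Submodule.sub_mem (R := ℝ) (M := OpTensor V) _ h3 h2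
  exact h4

/-- `q ⊗ a`, as the bilinear map `(x, y) ↦ q(x, y) a`. -/
def formTmul (q : V →ₗ[ℝ] V →ₗ[ℝ] ℝ) (a : V) : V →ₗ[ℝ] V →ₗ[ℝ] V :=
  q.compr₂ (LinearMap.toSpanSingleton ℝ V a)

theorem formTmul_apply (q : V →ₗ[ℝ] V →ₗ[ℝ] ℝ) (a x y : V) : formTmul q a x y = q x y • a := rfl

theorem formTmul_mem {q : V →ₗ[ℝ] V →ₗ[ℝ] ℝ} (hq : q ∈ S2 V) (a : V) : formTmul q a ∈ S2V V :=
  fun x y => by rw [formTmul_apply, formTmul_apply, hq x y]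

/-- The symmetric form `(x, y) ↦ α(x) β(y) + β(x) α(y)`. -/
def symProd (α β : V →ₗ[ℝ] ℝ) : V →ₗ[ℝ] V →ₗ[ℝ] ℝ := α.smulRight β + β.smulRight α

theorem symProd_apply (α β : V →ₗ[ℝ] ℝ) (x y : V) :
    symProd α β x y = α x * β y + β x * α y := rfl

theorem symProd_mem (α β : V →ₗ[ℝ] ℝ) : symProd α β ∈ S2 V :=
  fun x y => by rw [symProd_apply, symProd_apply]; ring

/-- The symmetric bilinear map `(x, y) ↦ α(x) y + α(y) x`. -/
def symId (α : V →ₗ[ℝ] ℝ) : V →ₗ[ℝ] V →ₗ[ℝ] V :=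
  α.smulRight LinearMap.id + (α.smulRight LinearMap.id).flip

theorem symId_apply (α : V →ₗ[ℝ] ℝ) (x y : V) : symId α x y = α x • y + α y • x := rfl

theorem symId_mem (α : V →ₗ[ℝ] ℝ) : symId α ∈ S2V V :=
  fun x y => by rw [symId_apply, symId_apply, add_comm]

/-- Polarize `symId α` against `h ⊗ e` with `α e ≠ 0`. The coefficient of `e` is totally symmetric
in `w, v, u` and cancels, leaving `-α(e) 𝓡_h`. -/
theorem opOfForm_mem_symMapSpan [Nontrivial V] {h : V →ₗ[ℝ] V →ₗ[ℝ] ℝ} (hh : h ∈ S2 V) :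
    opOfForm h ∈ symMapSpan V := by
  obtain ⟨e, he⟩ := exists_ne (0 : V)
  obtain ⟨α, hα⟩ := Module.Projective.exists_dual_ne_zero ℝ he
  have key : opOfForm h = -((α e)⁻¹ • polarOp (symId α) (formTmul h e)) := by
    ext w v u
    have h1 : polarOp (symId α) (formTmul h e) w v u = α e • (h w u • v - h v u • w) := by
      simp only [polarOp_apply, symId_apply, formTmul_apply, map_add, map_smul, hh w v]
      module
    simp only [LinearMap.neg_apply, LinearMap.smul_apply, h1, opOfForm_apply]
    rw [inv_smul_smul₀ hα]
    abel
  rw [key]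
  have h2 := polarOp_mem_symMapSpan (symId_mem α) (formTmul_mem hh e)
  have h3 := Submodule.smul_mem _ (α e)⁻¹ h2
  have h4 := Submodule.neg_mem (R := ℝ) (M := OpTensor V) _ h3
  exact h4

/-! ### Basis contractions of the two composites in a polarization -/

section Basis

variable {ι : Type*} [Fintype ι] (b : Module.Basis ι ℝ V)

theorem trace_eq_sum_coord (f : Module.End ℝ V) :
    LinearMap.trace ℝ V f = ∑ k, b.coord k (f (b k)) := by
  classical
  simp [LinearMap.trace_eq_matrix_trace ℝ b, Matrix.trace, LinearMap.toMatrix_apply]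

theorem sum_coord_smul_apply {W : Type*} [AddCommGroup W] [Module ℝ W] (f : V →ₗ[ℝ] W) (v : V) :
    ∑ j, b.coord j v • f (b j) = f v := by
  conv_rhs => rw [← b.sum_repr v, map_sum]
  simp

variable (E : V →ₗ[ℝ] V →ₗ[ℝ] V →ₗ[ℝ] V)

/-- The sums over `j` and `k` reassemble `E v w u`. In the sum over `i`, one half of the symmetric
product gives the dimension, the other gives `1`. -/
theorem sum_symProd_formTmul (w v u : V) :
    ∑ j, ∑ k, ∑ i, formTmul (symProd (b.coord j) (b.coord i)) (b k) v
      (formTmul ((E (b j)).compr₂ (b.coord k)) (b i) w u) =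
    (Fintype.card ι + 1 : ℝ) • E v w u := by
  classical
  have hk : ∀ j : ι, ∑ k, b.coord k (E (b j) w u) • b k = E (b j) w u :=
    fun j => sum_coord_smul_apply b LinearMap.id _
  have hi : ∀ j k : ι, ∑ i, formTmul (symProd (b.coord j) (b.coord i)) (b k) v
      (formTmul ((E (b j)).compr₂ (b.coord k)) (b i) w u) =
      ((Fintype.card ι + 1 : ℝ) * b.coord j v) • (b.coord k (E (b j) w u) • b k) := by
    intro j k
    simp only [formTmul_apply, symProd_apply, LinearMap.compr₂_apply, map_smul]
    rw [← Finset.smul_sum, ← Finset.sum_smul, smul_comm]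
    congr 1
    simp [Finset.sum_add_distrib, Finsupp.single_apply]
    ring
  simp only [hi, ← Finset.smul_sum, hk, mul_smul]
  congr 1
  exact sum_coord_smul_apply b ((E.flip w).flip u) v

/-- In the opposite order the sum over `k` closes into a trace, while the sum over `i` rebuilds `u`
and `w`. -/
theorem sum_formTmul_symProd (w v u : V) :
    ∑ j, ∑ k, ∑ i, formTmul ((E (b j)).compr₂ (b.coord k)) (b i) v
      (formTmul (symProd (b.coord j) (b.coord i)) (b k) w u) =
    LinearMap.trace ℝ V (E w v) • u + LinearMap.trace ℝ V (E u v) • w := by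
  have hi : ∀ j k : ι, ∑ i, formTmul ((E (b j)).compr₂ (b.coord k)) (b i) v
      (formTmul (symProd (b.coord j) (b.coord i)) (b k) w u) =
      b.coord k (E (b j) v (b k)) • (b.coord j w • u + b.coord j u • w) := by
    intro j k
    have hu := sum_coord_smul_apply b LinearMap.id u
    have hw := sum_coord_smul_apply b LinearMap.id w
    simp only [LinearMap.id_apply] at hu hw
    conv_rhs => rw [← hu, ← hw]
    simp only [formTmul_apply, symProd_apply, LinearMap.compr₂_apply, map_smul, Finset.smul_sum,
      ← Finset.sum_add_distrib]
    refine Finset.sum_congr rfl fun i _ => ?_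
    simp only [hu, hw]
    module
  have htr : ∀ x, LinearMap.trace ℝ V (E x v) =
      ∑ j, b.coord j x * LinearMap.trace ℝ V (E (b j) v) := fun x =>
    (sum_coord_smul_apply b (LinearMap.trace ℝ V ∘ₗ E.flip v) x).symm
  simp only [hi, ← Finset.sum_smul, ← trace_eq_sum_coord]
  rw [htr w, htr u, Finset.sum_smul, Finset.sum_smul, ← Finset.sum_add_distrib]
  refine Finset.sum_congr rfl fun j _ => ?_
  module

end Basis

/-! ### Recovering an affine curvature operator from its symmetrization -/

/-- The trilinear map `(v, w, u) ↦ F(w, v) u + F(u, v) w`. -/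
def symTensor (F : OpTensor V) : V →ₗ[ℝ] V →ₗ[ℝ] V →ₗ[ℝ] V :=
  F.flip + LinearMap.lflip.comp F.flip

theorem symTensor_apply (F : OpTensor V) (v w u : V) :
    symTensor F v w u = F w v u + F u v w := rfl

theorem symTensor_mem (F : OpTensor V) (v : V) : symTensor F v ∈ S2V V :=
  fun x y => by rw [symTensor_apply, symTensor_apply, add_comm]

theorem trace_symTensor (F : OpTensor V) (w v : V) :
    LinearMap.trace ℝ V (symTensor F w v) = rho34 F v w + rho14 F w v := by
  have h : symTensor F w v = F v w + (F.flip w).flip v := rfl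
  rw [h, map_add]
  rfl

theorem symTensor_sub {F : OpTensor V} (hF : F ∈ affineCurv V) (w v u : V) :
    symTensor F v w u - symTensor F w v u = (3 : ℝ) • F w v u := by
  obtain ⟨anti, bianchi, -, -⟩ := hF
  have h := bianchi u v w
  rw [anti v w u, add_assoc, neg_add_eq_sub] at h
  have h' : F w v u = F u v w + F w u v := by
    rw [← sub_eq_zero, ← neg_eq_zero, ← h]; abel
  have h3 : (3 : ℝ) • F w v u = F w v u + F w v u + F w v u := by module
  rw [symTensor_apply, symTensor_apply, anti v w u, anti u w v, h3]
  -- Only one of the three copies of `F w v u` on the right is expanded by Bianchi.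
  nth_rewrite 5 [h']
  abel

/-- The terms of the first kind give `3(m + 1) F`. In the trace terms `ρ₃₄` vanishes, and symmetry
of `ρ₁₄` cancels the multiples of `u`; what remains is `𝓡_ρ`. -/
theorem sum_polarOp_symTensor {ι : Type*} [Fintype ι] (b : Module.Basis ι ℝ V) {F : OpTensor V}
    (hF : F ∈ affineCurv V) :
    ∑ j, ∑ k, ∑ i, polarOp (formTmul (symProd (b.coord j) (b.coord i)) (b k))
      (formTmul ((symTensor F (b j)).compr₂ (b.coord k)) (b i)) =
    (3 * (Fintype.card ι + 1) : ℝ) • F + opOfForm (rho14 F) := by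
  ext w v u
  simp only [LinearMap.sum_apply, polarOp_apply, Finset.sum_sub_distrib, Finset.sum_add_distrib,
    sum_symProd_formTmul, sum_formTmul_symProd, trace_symTensor]
  have h := symTensor_sub hF w v u
  obtain ⟨-, -, sym, tr⟩ := hF
  rw [LinearMap.add_apply, LinearMap.add_apply, LinearMap.add_apply, LinearMap.smul_apply,
    LinearMap.smul_apply, LinearMap.smul_apply, opOfForm_apply, mul_comm, mul_smul, ← h, tr,
    sym w v, sym u v, sym u w]
  simp only [LinearMap.zero_apply]
  module

theorem affineCurv_le_symMapSpan [FiniteDimensional ℝ V] [Nontrivial V] :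
    affineCurv V ≤ symMapSpan V := by
  intro F hF
  have hsum := sum_polarOp_symTensor (Module.finBasis ℝ V) hF
  have hmem : (3 * (Fintype.card (Fin (Module.finrank ℝ V)) + 1) : ℝ) • F ∈ symMapSpan V := by
    rw [eq_sub_of_add_eq (G := OpTensor V) hsum.symm]
    refine Submodule.sub_mem (R := ℝ) (M := OpTensor V) _ (Submodule.sum_mem _ fun j _ => Submodule.sum_mem _ fun k _ =>
      Submodule.sum_mem _ fun i _ => polarOp_mem_symMapSpan (formTmul_mem (symProd_mem _ _) _)
        (formTmul_mem (fun x y => ?_) _)) (opOfForm_mem_symMapSpan hF.2.2.1)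
    rw [LinearMap.compr₂_apply, LinearMap.compr₂_apply, symTensor_mem F _ x y]
  exact (Submodule.smul_mem_iff _ (by positivity)).1 hmem

/-- Both trace conditions come from `tr(AB) = tr(BA)`: `ρ₃₄` is the trace of a commutator, and
`ρ₁₄(x, y) = tr(C x * C y) - tr(C (C x y))` is symmetric. -/
theorem opOfSymMap_mem_affineCurv {C : V →ₗ[ℝ] V →ₗ[ℝ] V} (hC : C ∈ S2V V) :
    opOfSymMap C ∈ affineCurv V := by
  have hrho : ∀ x y, rho14 (opOfSymMap C) x y =
      LinearMap.trace ℝ V (C x * C y) - LinearMap.trace ℝ V (C (C x y)) := by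
    intro x y
    rw [← map_sub]
    change LinearMap.trace ℝ V _ = _
    congr 1
    ext z
    simp only [LinearMap.flip_apply, opOfSymMap_apply, LinearMap.sub_apply, Module.End.mul_apply]
    rw [hC z y, hC z (C x y)]
  refine ⟨fun x y z => ?_, fun x y z => ?_, fun x y => ?_, ?_⟩
  · rw [opOfSymMap_apply, opOfSymMap_apply, neg_sub]
  · simp only [opOfSymMap_apply]
    rw [hC y x, hC z x, hC z y]
    abel
  · rw [hrho, hrho, LinearMap.trace_mul_comm, hC x y]
  · ext x y
    change LinearMap.trace ℝ V (C y * C x - C x * C y) = 0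
    rw [map_sub, LinearMap.trace_mul_comm, sub_self]

theorem sigmaS_eq_smul_opOfForm (ψ : S2 V) :
    sigmaS V ψ = (1 / ((Module.finrank ℝ V : ℝ) - 1)) • opOfForm ψ.1 := by
  ext x y z
  rw [sigmaS_apply, LinearMap.smul_apply, LinearMap.smul_apply, LinearMap.smul_apply,
    opOfForm_apply, ← neg_sub (Module.finrank ℝ V : ℝ) 1, one_div_neg_eq_neg_one_div, neg_smul,
    ← smul_neg, neg_sub]

theorem opOfForm_mem_symSummand (hV : 2 ≤ Module.finrank ℝ V) {h : V →ₗ[ℝ] V →ₗ[ℝ] ℝ}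
    (hh : h ∈ S2 V) : opOfForm h ∈ symSummand V := by
  have hm : ((Module.finrank ℝ V : ℝ) - 1) ≠ 0 := by
    have : (2 : ℝ) ≤ Module.finrank ℝ V := by exact_mod_cast hV
    linarith
  refine ⟨((Module.finrank ℝ V : ℝ) - 1) • ⟨h, hh⟩, ?_⟩
  rw [map_smul, sigmaS_eq_smul_opOfForm, smul_smul, mul_one_div_cancel hm, one_smul]

end

end AffineCurvature

theorem theorem4p3 {V : Type*} [AddCommGroup V] [Module ℝ V] [FiniteDimensional ℝ V]
    (hV : 4 ≤ Module.finrank ℝ V) :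
    ((∀ h ∈ AffineCurvature.S2 V,
        AffineCurvature.opOfForm h ∈ AffineCurvature.symSummand V) ∧
      AffineCurvature.symSummand V =
        Submodule.span ℝ {R | ∃ h ∈ AffineCurvature.S2 V, R = AffineCurvature.opOfForm h}) ∧
    ((∀ C ∈ AffineCurvature.S2V V,
        AffineCurvature.opOfSymMap C ∈ AffineCurvature.affineCurv V) ∧
      AffineCurvature.affineCurv V =
        Submodule.span ℝ {R | ∃ C ∈ AffineCurvature.S2V V, R = AffineCurvature.opOfSymMap C}) := by
  have : Nontrivial V := Module.nontrivial_of_finrank_pos (R := ℝ) (by omega)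
  have hform : ∀ h ∈ AffineCurvature.S2 V,
      AffineCurvature.opOfForm h ∈ AffineCurvature.symSummand V :=
    fun h hh => AffineCurvature.opOfForm_mem_symSummand (by omega) hh
  refine ⟨⟨hform, le_antisymm ?_ (Submodule.span_le.2 ?_)⟩,
    fun C hC => AffineCurvature.opOfSymMap_mem_affineCurv hC,
    le_antisymm AffineCurvature.affineCurv_le_symMapSpan (Submodule.span_le.2 ?_)⟩
  · rintro _ ⟨ψ, rfl⟩
    rw [AffineCurvature.sigmaS_eq_smul_opOfForm]
    exact Submodule.smul_mem _ _ (Submodule.subset_span ⟨ψ.1, ψ.2, rfl⟩)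
  · rintro _ ⟨h, hh, rfl⟩
    exact hform h hh
  · rintro _ ⟨C, hC, rfl⟩
    exact AffineCurvature.opOfSymMap_mem_affineCurv hC
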